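/- Let $X$ be a compact metric space. For a finite open cover $\alpha$ of a compact space $Y$ put $$\operatorname{ord}(\alpha)=\sup_{x\in Y}\#\{U\in\alpha : x\in U\}-1,\qquad \mathcal D(\alpha)=\min_{\beta\succ\alpha}\operatorname{ord}(\beta),$$ where $\beta$ runs over the finite open covers of $Y$ that refine $\alpha$ (if $Y=\emptyset$, the supremum is $0$). Let $\dim(Y)=\sup_\alpha\mathcal D(\alpha)$ be the topological dimension of $Y$ and, for a continuous map $\phi:Y\to Y$, let $$\operatorname{mdim}(Y,\phi)=\sup_{\alpha}\lim_{n\to\infty}\frac{\mathcal D\big(\alpha\vee\phi^{-1}(\alpha)\vee\dots\vee\phi^{-(n-1)}(\alpha)\big)}{n}\in[0,\infty]$$ be its mean dimension, the suprema being over all finite open covers $\alpha$ of $Y$. Let $\mathbb K=\mathbb N$ or $\mathbb Z$, endow $X^{\mathbb K}$ with the product topology, and endow the set $C^0(X^{\mathbb K})$ of all continuous maps $X^{\mathbb K}\to X^{\mathbb K}$ with the topology of uniform convergence. Suppose that $\dim(X)<\infty$. Then: 1. The set $\{\phi\in C^0(X^{\mathbb K}) : \operatorname{mdim}(X^{\mathbb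 K},\phi)=0\}$ is dense in $C^0(X^{\mathbb K})$. 2. For every $a\in[0,\infty]$: if there is $\psi\in C^0(X^{\mathbb K})$ with $\operatorname{mdim}(X^{\mathbb K},\psi)=a$, then the set $\{\phi\in C^0(X^{\mathbb K}) : \operatorname{mdim}(X^{\mathbb K},\phi)=a\}$ is dense in $C^0(X^{\mathbb K})$. 3. The function $\phi\mapsto\operatorname{mdim}(X^{\mathbb K},\phi)$ from $C^0(X^{\mathbb K})$ to $\mathbb R\cup\{\infty\}$ is either constant, or discontinuous at every point of $C^0(X^{\mathbb K})$. -/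

import Mathlib

open Set Filter

noncomputable section

namespace MeanDim

/-- `α` is a finite open cover of `Y`. -/
structure IsFiniteOpenCover {Y : Type*} [TopologicalSpace Y] (α : Set (Set Y)) : Prop where
  finite : α.Finite
  isOpen : ∀ U ∈ α, IsOpen U
  sUnion_eq : ⋃₀ α = univ

/-- `β ≻ α`: every member of `β` is contained in a member of `α`. -/
def Refines {Y : Type*} (β α : Set (Set Y)) : Prop :=
  ∀ V ∈ β, ∃ U ∈ α, V ⊆ U

/-- `ord(α) = sup_x (∑_{U ∈ α} 1_U(x)) - 1`: the largest number of members of `α` with a common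
point, minus one.  For a finite family `α` the supremum is bounded by the cardinality of `α`;
on the empty space it is `0`, so that the order is `-1`. -/
def ord {Y : Type*} (α : Set (Set Y)) : ℤ :=
  ((⨆ x : Y, {U ∈ α | x ∈ U}.ncard : ℕ) : ℤ) - 1

/-- `𝒟(α)`: the minimum of `ord(β)` over all finite open covers `β` finer than `α`.  If `α` is a
finite open cover, then this is the infimum of a nonempty set of integers `≥ -1`, hence it is
attained. -/
def covD {Y : Type*} [TopologicalSpace Y] (α : Set (Set Y)) : ℤ :=
  sInf {k : ℤ | ∃ β : Set (Set Y), IsFiniteOpenCover β ∧ Refines β α ∧ ord β = k}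

/-- The topological (covering) dimension `dim(Y) = sup_α 𝒟(α)`. -/
def topDim (Y : Type*) [TopologicalSpace Y] : EReal :=
  ⨆ (α : Set (Set Y)) (_ : IsFiniteOpenCover α), ((covD α : ℝ) : EReal)

/-- `α_0^{n-1} = α ∨ φ⁻¹(α) ∨ ⋯ ∨ φ^{-n+1}(α)`: all sets
`A_0 ∩ φ⁻¹(A_1) ∩ ⋯ ∩ φ^{-(n-1)}(A_{n-1})` with `A_0, …, A_{n-1} ∈ α`. -/
def dynJoin {Y : Type*} (φ : Y → Y) (α : Set (Set Y)) (n : ℕ) : Set (Set Y) :=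
  {S | ∃ A : Fin n → Set Y, (∀ i, A i ∈ α) ∧ S = ⋂ i : Fin n, (φ^[(i : ℕ)]) ⁻¹' (A i)}

/-- The mean dimension `mdim(Y, φ) = sup_α lim_{n → ∞} 𝒟(α_0^{n-1}) / n`.  On a compact metric
space `n ↦ 𝒟(α_0^{n-1})` is subadditive, so the limit exists; it is written as an upper limit,
which has the same value and needs no existence proof in the definition. -/
def mdim {Y : Type*} [TopologicalSpace Y] (φ : C(Y, Y)) : EReal :=
  ⨆ (α : Set (Set Y)) (_ : IsFiniteOpenCover α),
    limsup (fun n : ℕ => (((covD (dynJoin φ α n) : ℝ) / (n : ℝ) : ℝ) : EReal)) atTop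

end MeanDim

end

/-! ### Orders of covers, refinements and dynamical joins -/

namespace MeanDim

variable {Y Z : Type*}

/-! The topology of `X^K` sees only finitely many coordinates at a time, while mean dimension
ignores a finite-dimensional factor. For finite `E ⊆ K`, split `X^K ≅ X^E × X^K`, possible because
`K` minus `E` is again countably infinite. Let `θ` act as a truncation of `φ` on `X^E` and as `ψ` on
the other factor. Then `mdim θ = mdim ψ` (`mdim_prodMap`), and `θ → φ` uniformly as `E` grows. So
every attained value is attained densely (`dense_mdim_eq`); the identity attains `0`, and two
distinct values with dense fibres exclude continuity at any point.

The dimension-theoretic input is the subadditivity `covD_inter_le`. It bounds `𝒟` on `X^E` and shows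
that this factor adds at most a constant to `𝒟` of the dynamical join, which vanishes after division
by `n`. -/

theorem ord_le_of_forall {α : Set (Set Y)} {k : ℤ} (hk : -1 ≤ k)
    (h : ∀ x, ({U ∈ α | x ∈ U}.ncard : ℤ) ≤ k + 1) : ord α ≤ k := by
  have : (⨆ x : Y, {U ∈ α | x ∈ U}.ncard) ≤ (k + 1).toNat :=
    ciSup_le' fun x => by have := h x; omega
  unfold ord
  omega

theorem ncard_le_ord {α : Set (Set Y)} (hα : α.Finite) (x : Y) :
    ({U ∈ α | x ∈ U}.ncard : ℤ) ≤ ord α + 1 := by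
  have : {U ∈ α | x ∈ U}.ncard ≤ ⨆ x : Y, {U ∈ α | x ∈ U}.ncard := by
    refine le_ciSup (f := fun x : Y => {U ∈ α | x ∈ U}.ncard) ⟨α.ncard, ?_⟩ x
    rintro _ ⟨y, rfl⟩
    exact ncard_le_ncard (sep_subset _ _) hα
  unfold ord
  omega

theorem neg_one_le_ord (α : Set (Set Y)) : -1 ≤ ord α := by
  unfold ord
  omega

theorem Refines.refl (α : Set (Set Y)) : Refines α α := fun V hV => ⟨V, hV, Subset.rfl⟩

theorem Refines.trans {α β γ : Set (Set Y)} (h : Refines α β) (h' : Refines β γ) :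
    Refines α γ := fun V hV =>
  let ⟨U, hU, hVU⟩ := h V hV
  let ⟨W, hW, hUW⟩ := h' U hU
  ⟨W, hW, hVU.trans hUW⟩

theorem Refines.image2_inter {α β α' β' : Set (Set Y)} (h : Refines α α') (h' : Refines β β') :
    Refines (image2 (· ∩ ·) α β) (image2 (· ∩ ·) α' β') := by
  rintro _ ⟨A, hA, B, hB, rfl⟩
  obtain ⟨A', hA', hAA⟩ := h A hA
  obtain ⟨B', hB', hBB⟩ := h' B hB
  exact ⟨_, ⟨A', hA', B', hB', rfl⟩, inter_subset_inter hAA hBB⟩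

theorem Refines.preimage {α β : Set (Set Z)} (h : Refines α β) (f : Y → Z) :
    Refines (Set.preimage f '' α) (Set.preimage f '' β) := by
  rintro _ ⟨V, hV, rfl⟩
  obtain ⟨U, hU, hVU⟩ := h V hV
  exact ⟨_, mem_image_of_mem _ hU, preimage_mono hVU⟩

theorem ord_preimage_le {α : Set (Set Z)} (hα : α.Finite) (f : Y → Z) :
    ord (Set.preimage f '' α) ≤ ord α := by
  refine ord_le_of_forall (neg_one_le_ord α) fun x => ?_
  have hsub : {U ∈ Set.preimage f '' α | x ∈ U} ⊆ Set.preimage f '' {U ∈ α | f x ∈ U} := by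
    rintro _ ⟨⟨U, hU, rfl⟩, hx⟩
    exact ⟨U, ⟨hU, hx⟩, rfl⟩
  have hfin : {U ∈ α | f x ∈ U}.Finite := hα.subset (sep_subset _ _)
  have h1 := (ncard_le_ncard hsub (hfin.image _)).trans (ncard_image_le hfin)
  have h2 := ncard_le_ord hα (f x)
  omega

section Topology

variable [TopologicalSpace Y] [TopologicalSpace Z]

theorem covD_bddBelow (α : Set (Set Y)) :
    BddBelow {k : ℤ | ∃ β : Set (Set Y), IsFiniteOpenCover β ∧ Refines β α ∧ ord β = k} :=
  ⟨-1, by rintro _ ⟨β, -, -, rfl⟩; exact neg_one_le_ord β⟩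

theorem covD_le_ord {α β : Set (Set Y)} (hβ : IsFiniteOpenCover β) (h : Refines β α) :
    covD α ≤ ord β := csInf_le (covD_bddBelow α) ⟨β, hβ, h, rfl⟩

theorem IsFiniteOpenCover.exists_ord_eq {α : Set (Set Y)} (hα : IsFiniteOpenCover α) :
    ∃ β, IsFiniteOpenCover β ∧ Refines β α ∧ ord β = covD α :=
  Int.csInf_mem (s := {k : ℤ | ∃ β : Set (Set Y), IsFiniteOpenCover β ∧ Refines β α ∧ ord β = k})
    ⟨_, α, hα, .refl α, rfl⟩ (covD_bddBelow α)

theorem IsFiniteOpenCover.neg_one_le_covD {α : Set (Set Y)} (hα : IsFiniteOpenCover α) :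
    -1 ≤ covD α := by
  obtain ⟨β, -, -, h⟩ := hα.exists_ord_eq
  exact h ▸ neg_one_le_ord β

theorem IsFiniteOpenCover.covD_le_of_refines {α β : Set (Set Y)} (hβ : IsFiniteOpenCover β)
    (h : Refines β α) : covD α ≤ covD β := by
  obtain ⟨γ, hγ, hγβ, e⟩ := hβ.exists_ord_eq
  exact e ▸ covD_le_ord hγ (hγβ.trans h)

theorem isFiniteOpenCover_univ : IsFiniteOpenCover ({univ} : Set (Set Y)) :=
  ⟨finite_singleton _, by simp, by simp⟩

theorem IsFiniteOpenCover.preimage {α : Set (Set Z)} (hα : IsFiniteOpenCover α) {f : Y → Z}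
    (hf : Continuous f) : IsFiniteOpenCover (preimage f '' α) where
  finite := hα.finite.image _
  isOpen := by
    rintro _ ⟨U, hU, rfl⟩
    exact (hα.isOpen U hU).preimage hf
  sUnion_eq := by
    rw [sUnion_image, ← preimage_iUnion₂, ← sUnion_eq_biUnion, hα.sUnion_eq, preimage_univ]

theorem covD_preimage_le {α : Set (Set Z)} (hα : IsFiniteOpenCover α) {f : Y → Z}
    (hf : Continuous f) : covD (Set.preimage f '' α) ≤ covD α := by
  obtain ⟨β, hβ, hr, e⟩ := hα.exists_ord_eq
  exact e ▸ (covD_le_ord (hβ.preimage hf) (hr.preimage f)).trans (ord_preimage_le hβ.finite f)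

/-- Since `p ∘ s = id`, pulling back along `s` recovers `α` from its preimage under `p`, and
pullbacks do not increase `𝒟`. -/
theorem covD_le_preimage {α : Set (Set Z)} (hα : IsFiniteOpenCover α) {p : Y → Z} {s : Z → Y}
    (hp : Continuous p) (hs : Continuous s) (h : Function.LeftInverse p s) :
    covD α ≤ covD (Set.preimage p '' α) := by
  have := covD_preimage_le (hα.preimage hp) hs
  rwa [image_image, image_congr (g := id) fun U _ => by
    rw [← preimage_comp, h.comp_eq_id, preimage_id, id], image_id] at this

theorem IsFiniteOpenCover.inter {α β : Set (Set Y)} (hα : IsFiniteOpenCover α)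
    (hβ : IsFiniteOpenCover β) : IsFiniteOpenCover (image2 (· ∩ ·) α β) where
  finite := hα.finite.image2 _ hβ.finite
  isOpen := by
    rintro _ ⟨U, hU, V, hV, rfl⟩
    exact (hα.isOpen U hU).inter (hβ.isOpen V hV)
  sUnion_eq := by
    refine eq_univ_of_forall fun x => ?_
    obtain ⟨U, hU, hxU⟩ := hα.sUnion_eq.symm ▸ mem_univ x
    obtain ⟨V, hV, hxV⟩ := hβ.sUnion_eq.symm ▸ mem_univ x
    exact ⟨_, ⟨U, hU, V, hV, rfl⟩, hxU, hxV⟩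

theorem IsFiniteOpenCover.dynJoin {α : Set (Set Y)} (hα : IsFiniteOpenCover α) {φ : Y → Y}
    (hφ : Continuous φ) (n : ℕ) : IsFiniteOpenCover (dynJoin φ α n) where
  finite := by
    refine ((Set.Finite.pi' fun _ : Fin n => hα.finite).image
      fun A => ⋂ i : Fin n, (φ^[(i : ℕ)]) ⁻¹' (A i)).subset ?_
    rintro _ ⟨A, hA, rfl⟩
    exact ⟨A, hA, rfl⟩
  isOpen := by
    rintro _ ⟨A, hA, rfl⟩
    exact isOpen_iInter_of_finite fun i => (hα.isOpen _ (hA i)).preimage (hφ.iterate _)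
  sUnion_eq := by
    refine eq_univ_of_forall fun x => ?_
    have h (y : Y) : ∃ U ∈ α, y ∈ U := mem_sUnion.1 (hα.sUnion_eq.symm ▸ mem_univ y)
    choose U hU hxU using h
    exact ⟨_, ⟨fun i => U (φ^[(i : ℕ)] x), fun i => hU _, rfl⟩, mem_iInter.2 fun i => hxU _⟩

end Topology

theorem Refines.dynJoin {α β : Set (Set Y)} (h : Refines α β) (φ : Y → Y) (n : ℕ) :
    Refines (dynJoin φ α n) (dynJoin φ β n) := by
  rintro _ ⟨A, hA, rfl⟩
  choose B hB hAB using fun i => h (A i) (hA i)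
  exact ⟨_, ⟨B, hB, rfl⟩, iInter_mono fun i => preimage_mono (hAB i)⟩

theorem dynJoin_inter_refines (α β : Set (Set Y)) (φ : Y → Y) (n : ℕ) :
    Refines (image2 (· ∩ ·) (dynJoin φ α n) (dynJoin φ β n))
      (dynJoin φ (image2 (· ∩ ·) α β) n) := by
  rintro _ ⟨_, ⟨A, hA, rfl⟩, _, ⟨B, hB, rfl⟩, rfl⟩
  refine ⟨_, ⟨fun i => A i ∩ B i, fun i => ⟨_, hA i, _, hB i, rfl⟩, rfl⟩, ?_⟩
  simp only [preimage_inter, iInter_inter_distrib]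
  exact Subset.rfl

theorem dynJoin_preimage {α : Set (Set Z)} {p : Y → Z} {φ : Y → Y} {ψ : Z → Z}
    (h : Function.Semiconj p φ ψ) (n : ℕ) :
    dynJoin φ (Set.preimage p '' α) n = Set.preimage p '' dynJoin ψ α n := by
  have key (A : Fin n → Set Z) : ⋂ i : Fin n, (φ^[(i : ℕ)]) ⁻¹' (p ⁻¹' A i) =
      p ⁻¹' ⋂ i : Fin n, (ψ^[(i : ℕ)]) ⁻¹' A i := by
    rw [preimage_iInter]
    refine iInter_congr fun i => ?_
    rw [← preimage_comp, ← preimage_comp, (h.iterate_right i).comp_eq]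
  ext S
  constructor
  · rintro ⟨A, hA, rfl⟩
    choose B hB hAB using hA
    obtain rfl : (fun i => p ⁻¹' B i) = A := funext hAB
    exact ⟨_, ⟨B, hB, rfl⟩, (key B).symm⟩
  · rintro ⟨_, ⟨B, hB, rfl⟩, rfl⟩
    exact ⟨fun i => p ⁻¹' B i, fun i => ⟨_, hB i, rfl⟩, (key B).symm⟩

end MeanDim

/-! ### Subadditivity of `𝒟` -/

namespace MeanDim

open Finset in
/-- Two partitions of `[0, 1]` into `p` and `q` nondegenerate intervals have a common refinement
into at most `p + q - 1` nondegenerate intervals. -/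
theorem card_common_refinement {n m : ℕ} {a : Fin n → ℝ} {b : Fin m → ℝ} (ha : ∀ i, 0 ≤ a i)
    (hb : ∀ j, 0 ≤ b j) (ha' : ∃ i, 0 < a i) (hb' : ∃ j, 0 < b j)
    (S : Finset (Fin n × Fin m))
    (hS : ∀ p, p ∈ S ↔ max (∑ k ∈ Iio p.1, a k) (∑ k ∈ Iio p.2, b k) <
      min (∑ k ∈ Iic p.1, a k) (∑ k ∈ Iic p.2, b k)) :
    S.Nonempty ∧ #S + 1 ≤ #{i | 0 < a i} + #{j | 0 < b j} := by
  classical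
  have first {l : ℕ} {c : Fin l → ℝ} (hc : ∀ i, 0 ≤ c i) (h : ∃ i, 0 < c i) :
      ∃ i, 0 < c i ∧ ∑ k ∈ Iio i, c k = 0 := by
    have hne : (univ.filter fun i => 0 < c i).Nonempty := by
      obtain ⟨i, hi⟩ := h
      exact ⟨i, by simpa using hi⟩
    refine ⟨_, (Finset.mem_filter.1 (Finset.min'_mem _ hne)).2, Finset.sum_eq_zero fun k hk => ?_⟩
    by_contra hk0
    have : k ∈ univ.filter fun i => 0 < c i := by
      simpa using lt_of_le_of_ne (hc k) (Ne.symm hk0)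
    exact absurd (Finset.min'_le _ _ this) (not_le.2 (Finset.mem_Iio.1 hk))
  have step {l : ℕ} (c : Fin l → ℝ) (i : Fin l) :
      ∑ k ∈ Iic i, c k = ∑ k ∈ Iio i, c k + c i := by
    rw [← Finset.Iio_insert, Finset.sum_insert (by simp), add_comm]
  have mono {l : ℕ} {c : Fin l → ℝ} (hc : ∀ i, 0 ≤ c i) {i j : Fin l} (hij : i < j) :
      ∑ k ∈ Iic i, c k ≤ ∑ k ∈ Iio j, c k :=
    Finset.sum_le_sum_of_subset_of_nonneg
      (fun k hk => Finset.mem_Iio.2 ((Finset.mem_Iic.1 hk).trans_lt hij)) fun k _ _ => hc k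
  have inj {l : ℕ} {c : Fin l → ℝ} (hc : ∀ i, 0 ≤ c i) {i j : Fin l} {t : ℝ}
      (h1 : ∑ k ∈ Iio i, c k ≤ t) (h2 : t < ∑ k ∈ Iic i, c k)
      (h3 : ∑ k ∈ Iio j, c k ≤ t) (h4 : t < ∑ k ∈ Iic j, c k) : i = j := by
    rcases lt_trichotomy i j with h | h | h
    · linarith [mono hc h]
    · exact h
    · linarith [mono hc h]
  obtain ⟨i₀, hi₀, hi₀'⟩ := first ha ha'
  obtain ⟨j₀, hj₀, hj₀'⟩ := first hb hb'
  refine ⟨⟨(i₀, j₀), (hS _).2 ?_⟩, ?_⟩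
  · simp only [step, hi₀', hj₀']
    simp [hi₀, hj₀]
  set A : Finset ℝ := (univ.filter fun i => 0 < a i).image fun i => ∑ k ∈ Iio i, a k
  set B : Finset ℝ := (univ.filter fun j => 0 < b j).image fun j => ∑ k ∈ Iio j, b k
  -- A common interval is determined by its left endpoint, which is a left endpoint of one of the
  -- two partitions.
  have hSc : #S ≤ #(A ∪ B) := by
    refine Finset.card_le_card_of_injOn
      (fun p => max (∑ k ∈ Iio p.1, a k) (∑ k ∈ Iio p.2, b k)) ?_ ?_
    · intro p hp
      have h := (hS p).1 hp
      simp only [max_lt_iff, lt_min_iff, step] at h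
      have h1 : 0 < a p.1 := by linarith [h.1.1]
      have h2 : 0 < b p.2 := by linarith [h.2.2]
      rcases max_choice (∑ k ∈ Iio p.1, a k) (∑ k ∈ Iio p.2, b k) with e | e
      · exact Finset.mem_union_left _ (Finset.mem_image.2 ⟨p.1, by simpa using h1, e.symm⟩)
      · exact Finset.mem_union_right _ (Finset.mem_image.2 ⟨p.2, by simpa using h2, e.symm⟩)
    · intro p hp q hq hpq
      have h := (hS p).1 hp
      have h' := (hS q).1 hq
      simp only at hpq
      rw [lt_min_iff] at h h'
      rw [← hpq] at h'
      exact Prod.ext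
        (inj ha (le_max_left _ _) h.1 (hpq ▸ le_max_left _ _) h'.1)
        (inj hb (le_max_right _ _) h.2 (hpq ▸ le_max_right _ _) h'.2)
  -- Both partitions start at `0`; this shared endpoint saves the one in `p + q - 1`.
  have h0 : 0 < #(A ∩ B) := Finset.card_pos.2 ⟨0, Finset.mem_inter.2
    ⟨Finset.mem_image.2 ⟨i₀, by simpa using hi₀, hi₀'⟩,
      Finset.mem_image.2 ⟨j₀, by simpa using hj₀, hj₀'⟩⟩⟩
  have h1 := Finset.card_union_add_card_inter A B
  have hA : #A ≤ #{i | 0 < a i} := Finset.card_image_le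
  have hB : #B ≤ #{j | 0 < b j} := Finset.card_image_le
  omega

variable {Y : Type*} [TopologicalSpace Y]

/-- A finite open cover of a normal space carries a finite partition of unity with at most
`ord α + 1` nonzero functions at every point. -/
theorem IsFiniteOpenCover.exists_partition [NormalSpace Y] {α : Set (Set Y)}
    (hα : IsFiniteOpenCover α) :
    ∃ (n : ℕ) (f : Fin n → C(Y, ℝ)), (∀ i x, 0 ≤ f i x) ∧ (∀ x, ∃ i, 0 < f i x) ∧
      (∀ i, ∃ U ∈ α, {x | 0 < f i x} ⊆ U) ∧
      ∀ x, ((Finset.univ.filter fun i => 0 < f i x).card : ℤ) ≤ ord α + 1 := by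
  obtain ⟨n, U, hU, rfl⟩ := hα.finite.fin_param
  obtain ⟨f, hf⟩ := PartitionOfUnity.exists_isSubordinate_of_locallyFinite isClosed_univ U
    (fun i => hα.isOpen _ (mem_range_self i)) (locallyFinite_of_finite U)
    (by rw [← sUnion_range, hα.sUnion_eq])
  have hsub (i : Fin n) : {x | 0 < f i x} ⊆ U i := fun x hx =>
    hf i (subset_tsupport _ (ne_of_gt hx))
  refine ⟨n, f, fun i x => f.nonneg i x, fun x => f.exists_pos (mem_univ x),
    fun i => ⟨U i, mem_range_self i, hsub i⟩, fun x => ?_⟩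
  refine le_trans ?_ (ncard_le_ord hα.finite x)
  rw [← ncard_coe_finset, Nat.cast_le]
  refine ncard_le_ncard_of_injOn U ?_ hU.injOn (hα.finite.subset (sep_subset _ _))
  intro i hi
  exact ⟨mem_range_self i, hsub i (by simpa using hi)⟩

/-- Subadditivity of `𝒟` under common refinements. -/
theorem covD_inter_le [NormalSpace Y] [Nonempty Y] {α β : Set (Set Y)}
    (hα : IsFiniteOpenCover α) (hβ : IsFiniteOpenCover β) :
    covD (image2 (· ∩ ·) α β) ≤ covD α + covD β := by
  classical
  obtain ⟨α', hα', hr, e⟩ := hα.exists_ord_eq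
  obtain ⟨β', hβ', hr', e'⟩ := hβ.exists_ord_eq
  obtain ⟨n, f, hf0, hfp, hfU, hfc⟩ := hα'.exists_partition
  obtain ⟨m, g, hg0, hgp, hgU, hgc⟩ := hβ'.exists_partition
  -- Over each `x`, lay intervals of lengths `f i x` end to end from `0`, and likewise for `g`. `W
  -- (i, j)` is where the `i`-th and `j`-th intervals overlap in positive length.
  let W : Fin n × Fin m → Set Y := fun p =>
    {x | max (∑ k ∈ Finset.Iio p.1, f k x) (∑ k ∈ Finset.Iio p.2, g k x) <
      min (∑ k ∈ Finset.Iic p.1, f k x) (∑ k ∈ Finset.Iic p.2, g k x)}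
  have key (x : Y) := card_common_refinement (fun i => hf0 i x) (fun j => hg0 j x) (hfp x) (hgp x)
    (Finset.univ.filter fun p => x ∈ W p) (fun p => by simp [W])
  have hW : IsFiniteOpenCover (range W) := by
    refine ⟨finite_range W, ?_, eq_univ_of_forall fun x => ?_⟩
    · rintro _ ⟨p, rfl⟩
      exact isOpen_lt (by fun_prop) (by fun_prop)
    · obtain ⟨p, hp⟩ := (key x).1
      exact ⟨_, mem_range_self p, by simpa using hp⟩
  have hWr : Refines (range W) (image2 (· ∩ ·) α' β') := by
    rintro _ ⟨⟨i, j⟩, rfl⟩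
    obtain ⟨U, hU, hiU⟩ := hfU i
    obtain ⟨V, hV, hjV⟩ := hgU j
    refine ⟨_, ⟨U, hU, V, hV, rfl⟩, fun x hx => ?_⟩
    simp only [W, mem_ofPred_eq, max_lt_iff, lt_min_iff, ← Finset.Iio_insert] at hx
    rw [Finset.sum_insert (by simp), Finset.sum_insert (by simp)] at hx
    exact ⟨hiU (by simp only [mem_ofPred_eq]; linarith [hx.1.1]),
      hjV (by simp only [mem_ofPred_eq]; linarith [hx.2.2])⟩
  have hbound (x : Y) : ({U ∈ range W | x ∈ U}.ncard : ℤ) ≤ ord α' + ord β' + 1 := by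
    have hsub : {U ∈ range W | x ∈ U} ⊆
        W '' (Finset.univ.filter fun p => x ∈ W p : Finset (Fin n × Fin m)) := by
      rintro _ ⟨⟨p, rfl⟩, hp⟩
      exact ⟨p, by simpa using hp, rfl⟩
    have h1 := (ncard_le_ncard hsub (toFinite _)).trans (ncard_image_le (toFinite _))
    rw [ncard_coe_finset] at h1
    have h2 := (key x).2
    have h3 := hfc x
    have h4 := hgc x
    omega
  -- A point is needed: on the empty space the claim would read `-1 ≤ -2`.
  have hnonneg : -1 ≤ ord α' + ord β' := by
    obtain ⟨x⟩ := ‹Nonempty Y›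
    have := hbound x
    omega
  rw [← e, ← e']
  exact (covD_le_ord hW (hWr.trans (hr.image2_inter hr'))).trans (ord_le_of_forall hnonneg hbound)

end MeanDim

/-! ### Mean dimension of factors and products; finite powers -/

namespace MeanDim

open Topology Uniformity

variable {Y Z F : Type*}

theorem mdim_le_of_section [TopologicalSpace Y] [TopologicalSpace Z] {φ : C(Y, Y)} {ψ : C(Z, Z)}
    {p : Y → Z} {s : Z → Y} (hp : Continuous p) (hs : Continuous s)
    (h : Function.LeftInverse p s) (hsc : Function.Semiconj p φ ψ) : mdim ψ ≤ mdim φ := by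
  refine iSup₂_le fun α hα => le_iSup₂_of_le (Set.preimage p '' α) (hα.preimage hp) ?_
  refine limsup_le_limsup (Eventually.of_forall fun n => ?_)
  beta_reduce
  rw [dynJoin_preimage hsc, EReal.coe_le_coe_iff]
  gcongr
  exact covD_le_preimage (hα.dynJoin ψ.continuous n) hp hs h

theorem mdim_conj [TopologicalSpace Y] [TopologicalSpace Z] {φ : C(Y, Y)} {ψ : C(Z, Z)}
    (e : Y ≃ₜ Z) (h : Function.Semiconj e φ ψ) : mdim φ = mdim ψ := by
  refine le_antisymm (mdim_le_of_section e.symm.continuous e.continuous e.left_inv ?_)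
    (mdim_le_of_section e.continuous e.symm.continuous e.right_inv h)
  exact h.inverse_left e.left_inv e.right_inv

theorem mdim_id [TopologicalSpace Y] : mdim (ContinuousMap.id Y) = 0 := by
  refine le_antisymm (iSup₂_le fun α hα => ?_) (le_iSup₂_of_le {univ} isFiniteOpenCover_univ ?_)
  · have hr (n : ℕ) : Refines α (dynJoin (ContinuousMap.id Y) α n) := fun U hU =>
      ⟨_, ⟨fun _ => U, fun _ => hU, rfl⟩, subset_iInter fun i => by simp⟩
    have ht : Tendsto (fun n : ℕ => (((covD α : ℝ) / (n : ℝ) : ℝ) : EReal)) atTop (𝓝 0) :=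
      continuous_coe_real_ereal.continuousAt.tendsto.comp (tendsto_const_div_atTop_nhds_zero_nat _)
    refine (limsup_le_limsup (Eventually.of_forall fun n => ?_)).trans ht.limsup_eq.le
    rw [EReal.coe_le_coe_iff]
    gcongr
    exact hα.covD_le_of_refines (hr n)
  -- Only `-1 ≤ 𝒟` is available, as the space may be empty; it suffices after division by `n`.
  · have ht : Tendsto (fun n : ℕ => (((-1 : ℝ) / (n : ℝ) : ℝ) : EReal)) atTop (𝓝 0) :=
      continuous_coe_real_ereal.continuousAt.tendsto.comp (tendsto_const_div_atTop_nhds_zero_nat _)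
    refine ht.limsup_eq.ge.trans (limsup_le_limsup (Eventually.of_forall fun n => ?_))
    rw [EReal.coe_le_coe_iff]
    gcongr
    exact_mod_cast (isFiniteOpenCover_univ.dynJoin
      (ContinuousMap.id Y).continuous n).neg_one_le_covD

theorem exists_finite_ball_cover [UniformSpace Y] [CompactSpace Y] {V : SetRel Y Y} (hV : V ∈ 𝓤 Y)
    (hVo : IsOpen V) :
    ∃ t : Set Y, IsFiniteOpenCover ((fun y => UniformSpace.ball y V) '' t) := by
  obtain ⟨t, -, hc⟩ := isCompact_univ.elim_nhds_subcover (X := Y)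
    (fun y => UniformSpace.ball y V) fun y _ => UniformSpace.ball_mem_nhds y hV
  refine ⟨t, t.finite_toSet.image _, ?_, ?_⟩
  · rintro _ ⟨y, -, rfl⟩
    exact UniformSpace.isOpen_ball y hVo
  · rw [sUnion_image]
    exact univ_subset_iff.1 hc

/-- Every open cover of a product of compact spaces is refined by a product of finite covers. -/
theorem IsFiniteOpenCover.exists_prod_refines [UniformSpace F] [CompactSpace F] [UniformSpace Z]
    [CompactSpace Z] {α : Set (Set (F × Z))} (hα : IsFiniteOpenCover α) :
    ∃ β : Set (Set F), ∃ γ : Set (Set Z), IsFiniteOpenCover β ∧ IsFiniteOpenCover γ ∧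
      Refines (image2 (· ∩ ·) (Set.preimage Prod.fst '' β) (Set.preimage Prod.snd '' γ)) α := by
  obtain ⟨V, hV, hVα⟩ := lebesgue_number_lemma_sUnion isCompact_univ hα.isOpen hα.sUnion_eq.ge
  obtain ⟨⟨V₁, V₂⟩, ⟨⟨hV₁, hV₁o⟩, hV₂, hV₂o⟩, hsub⟩ :=
    (uniformity_hasBasis_open.uniformity_prod uniformity_hasBasis_open).mem_iff.1 hV
  obtain ⟨s, hs⟩ := exists_finite_ball_cover hV₁ hV₁o
  obtain ⟨t, ht⟩ := exists_finite_ball_cover hV₂ hV₂o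
  refine ⟨_, _, hs, ht, ?_⟩
  rintro _ ⟨_, ⟨_, ⟨x, -, rfl⟩, rfl⟩, _, ⟨_, ⟨y, -, rfl⟩, rfl⟩, rfl⟩
  obtain ⟨A, hA, hxA⟩ := hVα (x, y) (mem_univ _)
  exact ⟨A, hA, fun q hq => hxA (hsub hq)⟩

theorem covD_prod_le [UniformSpace F] [CompactSpace F] [T2Space F] [UniformSpace Z]
    [CompactSpace Z] [T2Space Z] [Nonempty (F × Z)] {β : Set (Set F)} {γ : Set (Set Z)}
    (hβ : IsFiniteOpenCover β) (hγ : IsFiniteOpenCover γ) :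
    covD (image2 (· ∩ ·) (Set.preimage Prod.fst '' β) (Set.preimage Prod.snd '' γ)) ≤
      covD β + covD γ :=
  (covD_inter_le (hβ.preimage continuous_fst) (hγ.preimage continuous_snd)).trans
    (add_le_add (covD_preimage_le hβ continuous_fst) (covD_preimage_le hγ continuous_snd))

/-- A finite-dimensional factor does not contribute to the mean dimension of a product. -/
theorem mdim_prodMap [UniformSpace F] [CompactSpace F] [T2Space F] [UniformSpace Z]
    [CompactSpace Z] [T2Space Z] [Nonempty F] {d : ℤ}
    (hd : ∀ α : Set (Set F), IsFiniteOpenCover α → covD α ≤ d) [Nonempty Z] (T : C(F, F))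
    (ψ : C(Z, Z)) : mdim (T.prodMap ψ) = mdim ψ := by
  inhabit F
  refine le_antisymm (iSup₂_le fun α hα => ?_) (mdim_le_of_section (p := Prod.snd)
    (s := fun z => (default, z)) continuous_snd (by fun_prop) (fun _ => rfl) fun _ => rfl)
  obtain ⟨β, γ, hβ, hγ, hr⟩ := hα.exists_prod_refines
  -- The bound `d` holds for all covers of `F`, hence for every join under `T`, uniformly in `n`.
  have hle (n : ℕ) : covD (dynJoin (T.prodMap ψ) α n) ≤ d + covD (dynJoin ψ γ n) := by
    have hβ' := hβ.dynJoin T.continuous n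
    have hγ' := hγ.dynJoin ψ.continuous n
    have hr' := (dynJoin_inter_refines _ _ _ n).trans (hr.dynJoin (T.prodMap ψ) n)
    rw [dynJoin_preimage (p := Prod.fst) (ψ := T) fun _ => rfl,
      dynJoin_preimage (p := Prod.snd) (ψ := ψ) fun _ => rfl] at hr'
    refine (((hβ'.preimage continuous_fst).inter
      (hγ'.preimage continuous_snd)).covD_le_of_refines hr').trans ?_
    exact (covD_prod_le hβ' hγ').trans (by gcongr; exact hd _ hβ')
  have ht : Tendsto (fun n : ℕ => (((d : ℝ) / (n : ℝ) : ℝ) : EReal)) atTop (𝓝 0) :=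
    continuous_coe_real_ereal.continuousAt.tendsto.comp (tendsto_const_div_atTop_nhds_zero_nat _)
  calc _ ≤ limsup ((fun n : ℕ => (((d : ℝ) / (n : ℝ) : ℝ) : EReal)) +
          fun n : ℕ => (((covD (dynJoin ψ γ n) : ℝ) / (n : ℝ) : ℝ) : EReal)) atTop := by
        refine limsup_le_limsup (Eventually.of_forall fun n => ?_)
        simp only [Pi.add_apply]
        rw [← EReal.coe_add, EReal.coe_le_coe_iff, ← add_div]
        gcongr
        exact_mod_cast hle n
    _ ≤ _ := EReal.limsup_add_le (by simp [ht.limsup_eq]) (by simp [ht.limsup_eq])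
    _ ≤ mdim ψ := by
        rw [ht.limsup_eq, zero_add]
        exact le_iSup₂_of_le γ hγ le_rfl

/-- The values of `𝒟` on the finite open covers of `Y` are bounded. -/
def BoundedCovD (Y : Type*) [TopologicalSpace Y] : Prop :=
  ∃ d : ℤ, ∀ α : Set (Set Y), IsFiniteOpenCover α → covD α ≤ d

theorem boundedCovD_of_topDim_lt_top [TopologicalSpace Y] (h : topDim Y < ⊤) : BoundedCovD Y := by
  obtain ⟨r, hr, -⟩ := EReal.lt_iff_exists_real_btwn.1 h
  refine ⟨⌊r⌋, fun α hα => Int.le_floor.2 ?_⟩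
  have := (le_iSup₂ (f := fun (α : Set (Set Y)) (_ : IsFiniteOpenCover α) =>
    ((covD α : ℝ) : EReal)) α hα).trans hr.le
  exact_mod_cast this

theorem BoundedCovD.of_section [TopologicalSpace Y] [TopologicalSpace Z] (h : BoundedCovD Y)
    {p : Y → Z} {s : Z → Y} (hp : Continuous p) (hs : Continuous s)
    (hps : Function.LeftInverse p s) : BoundedCovD Z :=
  let ⟨d, hd⟩ := h
  ⟨d, fun _ hα => (covD_le_preimage hα hp hs hps).trans (hd _ (hα.preimage hp))⟩

theorem BoundedCovD.prod [UniformSpace F] [CompactSpace F] [T2Space F] [UniformSpace Z]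
    [CompactSpace Z] [T2Space Z] [Nonempty (F × Z)] (hF : BoundedCovD F) (hZ : BoundedCovD Z) :
    BoundedCovD (F × Z) := by
  obtain ⟨d, hd⟩ := hF
  obtain ⟨d', hd'⟩ := hZ
  refine ⟨d + d', fun α hα => ?_⟩
  obtain ⟨β, γ, hβ, hγ, hr⟩ := hα.exists_prod_refines
  exact ((hβ.preimage continuous_fst).inter
    (hγ.preimage continuous_snd)).covD_le_of_refines hr |>.trans
    ((covD_prod_le hβ hγ).trans (add_le_add (hd _ hβ) (hd' _ hγ)))

theorem boundedCovD_of_subsingleton [TopologicalSpace Y] [Subsingleton Y] : BoundedCovD Y := by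
  refine ⟨0, fun α hα => ?_⟩
  rcases isEmpty_or_nonempty Y with hY | ⟨⟨y⟩⟩
  · exact (covD_le_ord hα (.refl α)).trans (ord_le_of_forall (by simp) fun x => hY.elim x)
  · obtain ⟨U, hU, hyU⟩ := mem_sUnion.1 (hα.sUnion_eq.symm ▸ mem_univ y)
    have hU' : U = univ := eq_univ_of_forall fun x => Subsingleton.elim y x ▸ hyU
    refine (covD_le_ord (β := {univ}) isFiniteOpenCover_univ ?_).trans
      (ord_le_of_forall (by simp) fun x => ?_)
    · rintro _ rfl
      exact ⟨U, hU, hU'.ge⟩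
    · have := ncard_le_ncard (sep_subset ({univ} : Set (Set Y)) fun U => x ∈ U)
      rw [ncard_singleton] at this
      exact_mod_cast this

theorem BoundedCovD.pi {X : Type*} [UniformSpace X] [CompactSpace X] [T2Space X] [Nonempty X]
    (hX : BoundedCovD X) (ι : Type) [Finite ι] : BoundedCovD (ι → X) := by
  induction ι using Finite.induction_empty_option with
  | of_equiv e ih =>
    exact ih.of_section (Homeomorph.piCongrLeft (Y := fun _ => X) e).continuous
      (Homeomorph.piCongrLeft (Y := fun _ => X) e).symm.continuous (Homeomorph.piCongrLeft (Y := fun _ => X) e).right_inv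
  | h_empty => exact boundedCovD_of_subsingleton
  | h_option ih =>
    refine (hX.prod ih).of_section (p := fun q o => Option.elim o q.1 q.2)
      (s := fun f => (f none, fun i => f (some i))) ?_ (by fun_prop) ?_
    · refine continuous_pi fun o => ?_
      cases o <;> simp only [Option.elim] <;> fun_prop
    · intro f
      ext o
      cases o <;> rfl

end MeanDim

/-! ### Approximation in `C(X^K, X^K)` and density -/

namespace MeanDim

open Topology Uniformity

variable {X K : Type*}

theorem tendstoUniformly_of_forall_apply {ι Y : Type*} [UniformSpace X] {F : ι → Y → K → X}
    {f : Y → K → X} {p : Filter ι}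
    (h : ∀ k, TendstoUniformly (fun n x => F n x k) (fun x => f x k) p) :
    TendstoUniformly F f p := by
  rw [tendstoUniformly_iff_tendsto, Pi.uniformity, tendsto_iInf]
  exact fun k => tendsto_comap_iff.2 (tendstoUniformly_iff_tendsto.1 (h k))

/-- For an infinite countable index set, finitely many coordinates of `X^K` can be split off so
that the remaining factor is again `X^K`. -/
theorem exists_homeomorph_prod [TopologicalSpace X] [Countable K] [Infinite K] (E : Finset K) :
    ∃ h : (K → X) ≃ₜ (E → X) × (K → X), ∀ x i, (h x).1 i = x i := by
  classical
  have : Infinite {k // k ∉ E} := E.finite_toSet.infinite_compl.to_subtype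
  obtain ⟨e⟩ : Nonempty (K ≃ {k // k ∉ E}) := nonempty_equiv_of_countable
  refine ⟨{
    toFun := fun x => (fun i => x i, fun k => x (e k))
    invFun := fun q k => if hk : k ∈ E then q.1 ⟨k, hk⟩ else q.2 (e.symm ⟨k, hk⟩)
    left_inv := fun x => ?_
    right_inv := fun q => ?_
    continuous_toFun := by fun_prop
    continuous_invFun := ?_ }, fun _ _ => rfl⟩
  · ext k
    by_cases hk : k ∈ E <;> simp [hk]
  · refine Prod.ext (funext fun i => by simp) (funext fun k => ?_)
    simp [(e k).2]
  · refine continuous_pi fun k => ?_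
    by_cases hk : k ∈ E <;> simp only [hk, dite_true, dite_false] <;> fun_prop

variable [MetricSpace X] [CompactSpace X]

/-- `θ` is conjugate to `T × ψ`, where `T` applies `φ` with the second factor frozen at a base point
and keeps the coordinates in `E`. The map `r` is this freezing; it records how `θ` approximates `φ`.
-/
theorem exists_mdim_eq_of_finset {K : Type} [Countable K] [Infinite K] [Nonempty X]
    (hX : BoundedCovD X) (φ ψ : C(K → X, K → X)) (E : Finset K) :
    ∃ θ : C(K → X, K → X), mdim θ = mdim ψ ∧ ∃ r : (K → X) → (K → X),
      ∀ x, ∀ k ∈ E, r x k = x k ∧ θ x k = φ (r x) k := by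
  inhabit X
  obtain ⟨h, hh⟩ := exists_homeomorph_prod (X := X) E
  have hh' (q : (E → X) × (K → X)) (i : E) : h.symm q i = q.1 i := by
    rw [← hh (h.symm q) i, h.apply_symm_apply]
  obtain ⟨d, hd⟩ := hX.pi E
  let T : C(E → X, E → X) := ⟨fun u i => φ (h.symm (u, fun _ => default)) i, by fun_prop⟩
  let θ : C(K → X, K → X) := ⟨fun x => h.symm (T.prodMap ψ (h x)), by fun_prop⟩
  refine ⟨θ, ?_, fun x => h.symm ((h x).1, fun _ => default), fun x k hk => ⟨?_, ?_⟩⟩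
  · rw [← mdim_prodMap hd T ψ]
    exact mdim_conj h fun x => h.apply_symm_apply _
  · exact (hh' _ ⟨k, hk⟩).trans (hh x ⟨k, hk⟩)
  · exact hh' _ ⟨k, hk⟩

theorem dense_mdim_eq {K : Type} [Countable K] [Infinite K] (hX : topDim X < ⊤)
    (ψ : C(K → X, K → X)) : Dense {φ : C(K → X, K → X) | mdim φ = mdim ψ} := by
  intro φ
  rcases isEmpty_or_nonempty X with hXe | hXn
  · have : φ = ψ := ContinuousMap.ext fun x => (hXe.false (x (Classical.arbitrary K))).elim
    exact subset_closure (by simp [this])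
  choose θ hθ r hr using exists_mdim_eq_of_finset (boundedCovD_of_topDim_lt_top hX) φ ψ
  have hev (k : K) : ∀ᶠ E : Finset K in atTop, k ∈ E :=
    (eventually_ge_atTop {k}).mono fun E hE => hE (Finset.mem_singleton_self k)
  -- Each coordinate eventually lies in `E`, so `r → id` uniformly. Then `φ ∘ r → φ` by uniform
  -- continuity, and `θ` has the same `k`-th coordinate as `φ ∘ r` once `k ∈ E`.
  have hrt : TendstoUniformly r id atTop := tendstoUniformly_of_forall_apply fun k V hV => by
    filter_upwards [hev k] with E hE x
    rw [(hr E x k hE).1]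
    exact refl_mem_uniformity hV
  have hφr := (CompactSpace.uniformContinuous_of_continuous φ.continuous).comp_tendstoUniformly hrt
  have hθt : Tendsto θ atTop (𝓝 φ) := by
    refine ContinuousMap.tendsto_iff_tendstoUniformly.2 (tendstoUniformly_of_forall_apply ?_)
    intro k V hV
    have := (Pi.uniformContinuous_proj (fun _ => X) k).comp_tendstoUniformly hφr V hV
    filter_upwards [hev k, this] with E hE h x
    rw [(hr E x k hE).2]
    exact h x
  exact mem_closure_of_tendsto hθt (Eventually.of_forall hθ)

/-- Continuity at `x` would force `f x` into the closures of both `{b}` and `{c}`. -/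
theorem not_continuousAt_of_dense {A B : Type*} [TopologicalSpace A] [TopologicalSpace B]
    [T2Space B] {f : A → B} {b c : B} (hbc : b ≠ c) (hb : Dense {x | f x = b})
    (hc : Dense {x | f x = c}) (x : A) : ¬ ContinuousAt f x := by
  intro h
  have key {d : B} (hd : Dense {x | f x = d}) : f x = d := by
    have := h.continuousWithinAt.mem_closure_image (hd x)
    have hsub : f '' {x | f x = d} ⊆ {d} := by
      rintro _ ⟨y, hy, rfl⟩
      exact hy
    simpa using closure_mono hsub this
  exact hbc ((key hb).symm.trans (key hc))

end MeanDim

/-- `X^𝕂` is `𝕂 → X` with the product topology, and `C⁰(X^𝕂)` is `C(𝕂 → X, 𝕂 → X)` with the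
compact-open topology, which is the topology of uniform convergence since `X^𝕂` is compact. -/
theorem theorem5p5 {X : Type*} [MetricSpace X] [CompactSpace X]
    (hX : MeanDim.topDim X < ⊤) (K : Type) (hK : K = ℕ ∨ K = ℤ) :
    Dense {φ : C(K → X, K → X) | MeanDim.mdim φ = 0} ∧
    (∀ a : EReal, (∃ ψ : C(K → X, K → X), MeanDim.mdim ψ = a) →
      Dense {φ : C(K → X, K → X) | MeanDim.mdim φ = a}) ∧
    ((∃ c : EReal, ∀ φ : C(K → X, K → X), MeanDim.mdim φ = c) ∨
      (∀ φ : C(K → X, K → X),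
        ¬ ContinuousAt (fun θ : C(K → X, K → X) => MeanDim.mdim θ) φ)) := by
  have : Countable K := by rcases hK with rfl | rfl <;> infer_instance
  have : Infinite K := by rcases hK with rfl | rfl <;> infer_instance
  have key (a : EReal) (h : ∃ ψ : C(K → X, K → X), MeanDim.mdim ψ = a) :
      Dense {φ : C(K → X, K → X) | MeanDim.mdim φ = a} := by
    obtain ⟨ψ, rfl⟩ := h
    exact MeanDim.dense_mdim_eq hX ψ
  have h0 := key 0 ⟨_, MeanDim.mdim_id⟩
  refine ⟨h0, key, or_iff_not_imp_left.2 fun hc => ?_⟩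
  push Not at hc
  obtain ⟨ψ, hψ⟩ := hc 0
  exact MeanDim.not_continuousAt_of_dense hψ (key _ ⟨ψ, rfl⟩) h0
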